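/- Consider a smooth pure exchange economy with $L\ge 1$ goods and two consumers. Consumer $i\in\{1,2\}$ has an open convex consumption set $X_i\subseteq\mathbb R^L$ (for example $\mathbb R^L$ or $\mathbb R^L_{++}$) and a utility function $u_i$ that is $C^\infty$ on $X_i$, has positive partial derivatives at every point of $X_i$, and satisfies $D^2u_i(x)(v,v)<0$ for all $x\in X_i$ and all $v\ne 0$ with $Du_i(x)v=0$. Let $S=\{p\in\mathbb R^L : p_l>0 \text{ for all } l,\ p_L=1\}$. The demand $f_i(p,w)$ is the (unique, when it exists) maximizer of $u_i$ over $\{x\in X_i : p\cdot x\le w\}$. Fix total resources $r\in\mathbb R^L$, and let $E(r)$ be the set of all $(p,\omega_1,\omega_2)$ with $p\in S$, $\omega_1,\omega_2\in\mathbb R^L$, $\omega_1+\omega_2=r$, such that both demands $f_i(p,p\cdot\omega_i)$ exist and the excess demand $\sum_{i=1}^2 \bigl(f_i(p,p\cdot\omega_i)-\omega_i\bigr)$ is zero. Through the coordinates $(p_1,\dots,p_{L-1},\omega_1)$, which determine $p_L=1$ and $\omega_2=r-\omega_1$, regard $E(r)$ as a subset of the Euclidean space $\mathbb R^{2L-1}$.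 Then $E(r)$ is a smooth embedded $L$-dimensional submanifold of $\mathbb R^{2L-1}$, and for the Riemannian metric induced from the Euclidean metric all its sectional curvatures are non-positive: for every point $x\in E(r)$ and every $2$-dimensional subspace $\Pi\subseteq T_xE(r)$, $K(\Pi)\le 0$. Here $$K(\Pi)=\frac{\langle R(X,Y)X,Y\rangle}{|X|^2|Y|^2-\langle X,Y\rangle^2}$$ for any basis $X,Y$ of $\Pi$, where $R(X,Y)Z=\nabla_Y\nabla_XZ-\nabla_X\nabla_YZ+\nabla_{[X,Y]}Z$ and $\nabla$ is the Levi-Civita connection. -/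

import Mathlib

open scoped ContDiff

noncomputable section

/-! ### Smooth pure exchange economies

There are `n + 1` goods (so `L = n + 1`); the last good is the numeraire. -/

/-- Commodity bundles, endowments and price vectors of an economy with `n + 1` goods. -/
abbrev GoodsVec (n : ℕ) : Type := Fin (n + 1) → ℝ

/-- A smooth consumer: a preference on an open convex consumption set (for instance the whole
commodity space, or the strictly positive orthant), represented by a utility function that is
smooth, strictly monotone in the differentiable sense (positive marginal utilities) and strictly
quasi-concave in the differentiable sense (the Hessian is negative definite on the hyperplane
tangent to the indifference surface). -/
structure SmoothConsumer (n : ℕ) where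
  /-- the consumption set -/
  X : Set (GoodsVec n)
  isOpen_X : IsOpen X
  convex_X : Convex ℝ X
  /-- the utility function (only its values on `X` matter) -/
  u : GoodsVec n → ℝ
  smooth : ContDiffOn ℝ ∞ u X
  monotone : ∀ x ∈ X, ∀ l, 0 < fderiv ℝ u x (Pi.single l 1)
  quasiconcave : ∀ x ∈ X, ∀ v, v ≠ 0 → fderiv ℝ u x v = 0 →
    fderiv ℝ (fderiv ℝ u) x v v < 0

/-- `x` is the demand of consumer `c` at prices `p` and income `w`: it maximizes the utility of
`c` over the budget set. (By strict quasi-concavity there is at most one such `x`.) -/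
def IsDemand {n : ℕ} (c : SmoothConsumer n) (p : GoodsVec n) (w : ℝ) (x : GoodsVec n) : Prop :=
  (x ∈ c.X ∧ p ⬝ᵥ x ≤ w) ∧ ∀ y ∈ c.X, p ⬝ᵥ y ≤ w → c.u y ≤ c.u x

/-- The set `S` of normalized prices: positive coordinates, and the numeraire has price `1`. -/
def normalizedPrices (n : ℕ) : Set (GoodsVec n) :=
  {p | (∀ l, 0 < p l) ∧ p (Fin.last n) = 1}

/-- The equilibrium manifold `E` of the economy with consumers `c i`: the pairs `(p, ω)` of a
normalized price vector and an endowment profile at which aggregate excess demand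
`∑ i, f i (p, p ⬝ᵥ ω i) - ∑ i, ω i` is zero. -/
def equilibria {n M : ℕ} (c : Fin M → SmoothConsumer n) :
    Set (GoodsVec n × (Fin M → GoodsVec n)) :=
  {z | z.1 ∈ normalizedPrices n ∧
    ∃ x : Fin M → GoodsVec n, (∀ i, IsDemand (c i) z.1 (z.1 ⬝ᵥ z.2 i) (x i)) ∧
      ∑ i, x i - ∑ i, z.2 i = 0}

/-- The Euclidean space of dimension `2 L - 1 = n + (n + 1)` with the coordinates
`(p_1, …, p_{L-1}, ω_1^1, …, ω_1^L)`. With two consumers and total resources `r`, it contains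
`S × Ω(r)`, because `p_L = 1` and `ω_2 = r - ω_1`. -/
abbrev Ambient (n : ℕ) : Type := EuclideanSpace ℝ (Fin n ⊕ Fin (n + 1))

/-- The price vector with numeraire price `1` of a point of the ambient space. -/
def priceOf {n : ℕ} (z : Ambient n) : GoodsVec n :=
  Fin.snoc (α := fun _ => ℝ) (fun l : Fin n => z (Sum.inl l)) 1

/-- The endowment of the first consumer of a point of the ambient space. -/
def endowmentOf {n : ℕ} (z : Ambient n) : GoodsVec n := fun l => z (Sum.inr l)

/-- The equilibrium manifold `E(r)` of a two-consumer economy with total resources `r`, as a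
subset of Euclidean space. -/
def equilibriumManifold {n : ℕ} (c : Fin 2 → SmoothConsumer n) (r : GoodsVec n) :
    Set (Ambient n) :=
  {z | (priceOf z, ![endowmentOf z, r - endowmentOf z]) ∈ equilibria c}

/-! ### Submanifolds of Euclidean space and their sectional curvature -/

section Geometry

variable {m : ℕ} {V : Type*} [NormedAddCommGroup V] [InnerProductSpace ℝ V]

/-- `Φ` restricted to the open set `U ⊆ ℝ^m` is a smooth parametrization of an open piece of `N`:
an injective smooth immersion which is a homeomorphism onto a relatively open subset of `N`. -/
structure IsParametrization (N : Set V) (U : Set (Fin m → ℝ)) (Φ : (Fin m → ℝ) → V) : Prop where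
  isOpen : IsOpen U
  smooth : ContDiffOn ℝ ∞ Φ U
  immersion : ∀ x ∈ U, Function.Injective (fderiv ℝ Φ x)
  injOn : Set.InjOn Φ U
  open_image : ∀ U' ⊆ U, IsOpen U' → ∃ W : Set V, IsOpen W ∧ Φ '' U' = N ∩ W

/-- `N` is a smooth embedded `m`-dimensional submanifold of `V`. -/
def IsSubmanifold (m : ℕ) (N : Set V) : Prop :=
  ∀ z ∈ N, ∃ (U : Set (Fin m → ℝ)) (Φ : (Fin m → ℝ) → V),
    IsParametrization N U Φ ∧ z ∈ Φ '' U

/-- The partial derivative `∂f/∂x_i`. -/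
def pd {F : Type*} [NormedAddCommGroup F] [NormedSpace ℝ F]
    (i : Fin m) (f : (Fin m → ℝ) → F) (x : Fin m → ℝ) : F :=
  fderiv ℝ f x (Pi.single i 1)

/-- The induced metric `g_ij = ⟨∂_i Φ, ∂_j Φ⟩` in the coordinates given by `Φ`. -/
def inducedMetric (Φ : (Fin m → ℝ) → V) (x : Fin m → ℝ) : Matrix (Fin m) (Fin m) ℝ :=
  Matrix.of fun i j => inner ℝ (pd i Φ x) (pd j Φ x)

/-- The Christoffel symbols `Γ_ij^k` of the Levi-Civita connection of the metric `g`. -/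
def christoffel (g : (Fin m → ℝ) → Matrix (Fin m) (Fin m) ℝ) (i j k : Fin m)
    (x : Fin m → ℝ) : ℝ :=
  1 / 2 * ∑ h, (g x)⁻¹ h k *
    (pd i (fun y => g y j h) x + pd j (fun y => g y h i) x - pd h (fun y => g y i j) x)

/-- The coefficients `R_ijk^s` of the curvature tensor of the metric `g`, so that
`R(X_i, X_j) X_k = ∑ s, R_ijk^s X_s` with
`R(X, Y) Z = ∇_Y ∇_X Z - ∇_X ∇_Y Z + ∇_[X, Y] Z`. -/
def curvatureCoeff (g : (Fin m → ℝ) → Matrix (Fin m) (Fin m) ℝ) (i j k s : Fin m)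
    (x : Fin m → ℝ) : ℝ :=
  ∑ l, christoffel g i k l x * christoffel g j l s x
    - ∑ l, christoffel g j k l x * christoffel g i l s x
    + pd j (christoffel g i k s) x - pd i (christoffel g j k s) x

/-- The inner product `⟨X, Y⟩` of tangent vectors with coordinates `X`, `Y` at `x`. -/
def metricInner (g : (Fin m → ℝ) → Matrix (Fin m) (Fin m) ℝ) (x X Y : Fin m → ℝ) : ℝ :=
  ∑ i, ∑ j, g x i j * X i * Y j

/-- The number `⟨R(X, Y) X, Y⟩` for tangent vectors with coordinates `X`, `Y` at `x`. -/
def curvatureForm (g : (Fin m → ℝ) → Matrix (Fin m) (Fin m) ℝ) (x X Y : Fin m → ℝ) : ℝ :=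
  ∑ i, ∑ j, ∑ k, ∑ t, (∑ s, curvatureCoeff g i j k s x * g x s t) * X i * Y j * X k * Y t

/-- The sectional curvature `K(X, Y)` of the plane spanned by the tangent vectors with coordinates
`X`, `Y` at `x`. -/
def sectionalCurvature (g : (Fin m → ℝ) → Matrix (Fin m) (Fin m) ℝ)
    (x X Y : Fin m → ℝ) : ℝ :=
  curvatureForm g x X Y /
    (metricInner g x X X * metricInner g x Y Y - metricInner g x X Y ^ 2)

/-- All sectional curvatures of the `m`-dimensional submanifold `N`, with the metric induced from
`V`, are non-positive: at every point, in every local parametrization, and for every tangent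
`2`-plane. -/
def HasNonposSectionalCurvature (m : ℕ) (N : Set V) : Prop :=
  ∀ (U : Set (Fin m → ℝ)) (Φ : (Fin m → ℝ) → V), IsParametrization N U Φ →
    ∀ x ∈ U, ∀ X Y : Fin m → ℝ, LinearIndependent ℝ ![X, Y] →
      sectionalCurvature (inducedMetric Φ) x X Y ≤ 0

end Geometry

end

/-! Curvature. At fixed prices `p`, demand depends on the endowment only through income. Moving `ω₁`
by a vector `η` with `p · η = 0`, and `ω₂` by `-η`, therefore preserves equilibrium, so an affine
space of dimension `L - 1` passes through each point of `E(r)` and stays inside `E(r)`. A straight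
line in a submanifold has no acceleration, so the second fundamental form `II` satisfies `II(w, w) =
0` for its direction `w` (`IsParametrization.exists_asymptotic_direction`). These directions form a
hyperplane of the tangent space, which meets every tangent plane in some `w ≠ 0`. By the Gauss
equation (`curvatureForm_inducedMetric`) the numerator of `K` is `⟨II(X,X), II(Y,Y)⟩ - |II(X,Y)|²`.
In a basis `w, Y` of the plane it equals `-|II(w,Y)|² ≤ 0`.

Smoothness. By the first order conditions, an equilibrium amounts to a bundle `x` of consumer 1 at
which both marginal rates of substitution agree, together with a net trade of value zero at the
prices they define. The map `pointOf` from bundles and numeraire-free net trades, a space of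
dimension `2L - 1`, is a local diffeomorphism that turns `E(r)` into the zero set of `mrsGap`, and
this zero set is regular. Both facts rest on `fderiv_mrs_dotProduct_neg`: on trades of value zero,
the derivative of the marginal rates of substitution is negative definite. -/

noncomputable section

/-! ### Calculus of partial derivatives -/

section PartialDerivatives

variable {m : ℕ} {F : Type*} [NormedAddCommGroup F] [NormedSpace ℝ F]

theorem ContDiffOn.pd {f : (Fin m → ℝ) → F} {U : Set (Fin m → ℝ)} (hU : IsOpen U)
    (hf : ContDiffOn ℝ ∞ f U) (i : Fin m) : ContDiffOn ℝ ∞ (pd i f) U :=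
  (hf.fderiv_of_isOpen hU (by simp)).clm_apply contDiffOn_const

theorem ContDiffOn.differentiableAt_of_isOpen {E : Type*} [NormedAddCommGroup E] [NormedSpace ℝ E]
    {f : E → F} {U : Set E} (hU : IsOpen U)
    (hf : ContDiffOn ℝ ∞ f U) {x : E} (hx : x ∈ U) : DifferentiableAt ℝ f x :=
  (hf.contDiffAt (hU.mem_nhds hx)).differentiableAt (by simp)

theorem pd_pd_eq_fderiv_fderiv {f : (Fin m → ℝ) → F} {U : Set (Fin m → ℝ)} (hU : IsOpen U)
    (hf : ContDiffOn ℝ ∞ f U) {x : Fin m → ℝ} (hx : x ∈ U) (i j : Fin m) :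
    pd i (pd j f) x = fderiv ℝ (fderiv ℝ f) x (Pi.single i 1) (Pi.single j 1) := by
  have h : DifferentiableAt ℝ (fderiv ℝ f) x :=
    (hf.fderiv_of_isOpen hU (m := ∞) (by simp)).differentiableAt_of_isOpen hU hx
  have := (h.hasFDerivAt.clm_apply (hasFDerivAt_const (Pi.single j (1 : ℝ)) x)).fderiv
  unfold pd
  rw [this]
  simp

theorem ContDiffOn.fderiv_fderiv_comm {E : Type*} [NormedAddCommGroup E] [NormedSpace ℝ E]
    {f : E → F} {U : Set E} (hU : IsOpen U)
    (hf : ContDiffOn ℝ ∞ f U) {x : E} (hx : x ∈ U) (v w : E) :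
    fderiv ℝ (fderiv ℝ f) x v w = fderiv ℝ (fderiv ℝ f) x w v :=
  ((hf.contDiffAt (hU.mem_nhds hx)).isSymmSndFDerivAt
    (by rw [minSmoothness_of_isRCLikeNormedField]; exact WithTop.coe_le_coe.mpr le_top)).eq v w

theorem pd_comm {f : (Fin m → ℝ) → F} {U : Set (Fin m → ℝ)} (hU : IsOpen U)
    (hf : ContDiffOn ℝ ∞ f U) {x : Fin m → ℝ} (hx : x ∈ U) (i j : Fin m) :
    pd i (pd j f) x = pd j (pd i f) x := by
  rw [pd_pd_eq_fderiv_fderiv hU hf hx, pd_pd_eq_fderiv_fderiv hU hf hx,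
    hf.fderiv_fderiv_comm hU hx]

theorem pd_congr {f h : (Fin m → ℝ) → F} {U : Set (Fin m → ℝ)} (hU : IsOpen U)
    (hfh : ∀ y ∈ U, f y = h y) {x : Fin m → ℝ} (hx : x ∈ U) (i : Fin m) :
    pd i f x = pd i h x := by
  unfold pd
  rw [Filter.EventuallyEq.fderiv_eq (Filter.eventuallyEq_of_mem (hU.mem_nhds hx) hfh)]

theorem pd_inner {V : Type*} [NormedAddCommGroup V] [InnerProductSpace ℝ V]
    {f h : (Fin m → ℝ) → V} {x : Fin m → ℝ} (hf : DifferentiableAt ℝ f x)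
    (hh : DifferentiableAt ℝ h x) (i : Fin m) :
    pd i (fun y => inner ℝ (f y) (h y)) x
      = inner ℝ (pd i f x) (h x) + inner ℝ (f x) (pd i h x) := by
  unfold pd
  rw [fderiv_inner_apply ℝ hf hh, add_comm]

theorem pd_sum_mul {ι : Type*} {s : Finset ι} {a b : ι → (Fin m → ℝ) → ℝ} {x : Fin m → ℝ}
    (ha : ∀ l ∈ s, DifferentiableAt ℝ (a l) x) (hb : ∀ l ∈ s, DifferentiableAt ℝ (b l) x)
    (i : Fin m) :
    pd i (fun y => ∑ l ∈ s, a l y * b l y) x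
      = ∑ l ∈ s, (pd i (a l) x * b l x + a l x * pd i (b l) x) := by
  unfold pd
  rw [fderiv_fun_sum fun l hl => (ha l hl).fun_mul (hb l hl), sum_apply]
  refine Finset.sum_congr rfl fun l hl => ?_
  rw [fderiv_fun_mul (ha l hl) (hb l hl)]
  simp
  ring

theorem ContDiffOn.matrix_det {E ι : Type*} [NormedAddCommGroup E] [NormedSpace ℝ E]
    [Fintype ι] [DecidableEq ι] {U : Set E} {A : E → Matrix ι ι ℝ}
    (hA : ∀ i j, ContDiffOn ℝ ∞ (fun y => A y i j) U) :
    ContDiffOn ℝ ∞ (fun y => (A y).det) U := by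
  simp only [Matrix.det_apply]
  exact ContDiffOn.sum fun σ _ => (contDiffOn_prod fun i _ => hA _ _).const_smul _

/-- Cramer's rule: the inverse is the adjugate divided by the determinant, and both are polynomial
in the entries. -/
theorem ContDiffOn.matrix_inv {E ι : Type*} [NormedAddCommGroup E] [NormedSpace ℝ E]
    [Fintype ι] [DecidableEq ι] {U : Set E} {A : E → Matrix ι ι ℝ}
    (hA : ∀ i j, ContDiffOn ℝ ∞ (fun y => A y i j) U) (hdet : ∀ y ∈ U, (A y).det ≠ 0) (i j : ι) :
    ContDiffOn ℝ ∞ (fun y => (A y)⁻¹ i j) U := by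
  have hadj : ContDiffOn ℝ ∞ (fun y => (A y).adjugate i j) U := by
    simp only [Matrix.adjugate_apply]
    refine ContDiffOn.matrix_det fun k l => ?_
    by_cases hk : k = j
    · subst hk
      simpa [Matrix.updateRow_apply] using contDiffOn_const
    · simpa [Matrix.updateRow_apply, hk] using hA k l
  simp only [Matrix.inv_def, Matrix.smul_apply, Ring.inverse_eq_inv', smul_eq_mul]
  exact ((ContDiffOn.matrix_det hA).inv hdet).mul hadj

end PartialDerivatives

/-! ### The Gauss equation for an immersion -/

section GaussEquation

variable {m : ℕ} {V : Type*} [NormedAddCommGroup V] [InnerProductSpace ℝ V]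
  {U : Set (Fin m → ℝ)} {Φ : (Fin m → ℝ) → V} {x : Fin m → ℝ}

theorem fderiv_eq_sum_pd (x X : Fin m → ℝ) : fderiv ℝ Φ x X = ∑ i, X i • pd i Φ x := by
  conv_lhs => rw [pi_eq_sum_univ' X, map_sum]
  refine Finset.sum_congr rfl fun i _ => ?_
  rw [map_smul, pd]

theorem inner_fderiv_eq_metricInner (x X Y : Fin m → ℝ) :
    inner ℝ (fderiv ℝ Φ x X) (fderiv ℝ Φ x Y) = metricInner (inducedMetric Φ) x X Y := by
  simp only [fderiv_eq_sum_pd, sum_inner, inner_sum, inner_smul_left, inner_smul_right,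
    metricInner, inducedMetric, Matrix.of_apply, Finset.mul_sum]
  rw [Finset.sum_comm]
  refine Finset.sum_congr rfl fun i _ => Finset.sum_congr rfl fun j _ => ?_
  simp
  ring

theorem inducedMetric_det_ne_zero (hΦ : Function.Injective (fderiv ℝ Φ x)) :
    (inducedMetric Φ x).det ≠ 0 := by
  intro h
  obtain ⟨v, hv, hgv⟩ := Matrix.exists_mulVec_eq_zero_iff.mpr h
  refine hv (hΦ ?_)
  rw [map_zero, ← inner_self_eq_zero (𝕜 := ℝ), inner_fderiv_eq_metricInner, metricInner]
  refine Finset.sum_eq_zero fun i _ => ?_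
  have := congrFun hgv i
  simp only [Matrix.mulVec, dotProduct, Pi.zero_apply] at this
  calc _ = v i * ∑ j, inducedMetric Φ x i j * v j := by
        rw [Finset.mul_sum]; exact Finset.sum_congr rfl fun j _ => by ring
    _ = 0 := by rw [this, mul_zero]

theorem contDiffOn_inducedMetric (hU : IsOpen U) (hΦ : ContDiffOn ℝ ∞ Φ U) (i j : Fin m) :
    ContDiffOn ℝ ∞ (fun y => inducedMetric Φ y i j) U :=
  (hΦ.pd hU i).inner ℝ (hΦ.pd hU j)

theorem pd_inducedMetric (hU : IsOpen U) (hΦ : ContDiffOn ℝ ∞ Φ U) (hx : x ∈ U)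
    (i j k : Fin m) :
    pd i (fun y => inducedMetric Φ y j k) x
      = inner ℝ (pd i (pd j Φ) x) (pd k Φ x) + inner ℝ (pd j Φ x) (pd i (pd k Φ) x) :=
  pd_inner ((hΦ.pd hU j).differentiableAt_of_isOpen hU hx)
    ((hΦ.pd hU k).differentiableAt_of_isOpen hU hx) i

theorem contDiffOn_christoffel (hU : IsOpen U) (hΦ : ContDiffOn ℝ ∞ Φ U)
    (himm : ∀ y ∈ U, Function.Injective (fderiv ℝ Φ y)) (i j k : Fin m) :
    ContDiffOn ℝ ∞ (christoffel (inducedMetric Φ) i j k) U := by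
  have hg := contDiffOn_inducedMetric hU hΦ
  unfold christoffel
  refine contDiffOn_const.mul (ContDiffOn.sum fun h _ => ContDiffOn.mul ?_ ?_)
  · exact ContDiffOn.matrix_inv hg (fun y hy => inducedMetric_det_ne_zero (himm y hy)) h k
  · exact (((hg j h).pd hU i).add ((hg h i).pd hU j)).sub ((hg i j).pd hU h)

/-- The Christoffel symbols are the coefficients of the tangential part of `∂_i ∂_j Φ`. -/
theorem sum_christoffel_mul_inducedMetric (hU : IsOpen U) (hΦ : ContDiffOn ℝ ∞ Φ U)
    (himm : ∀ y ∈ U, Function.Injective (fderiv ℝ Φ y)) (hx : x ∈ U) (i j t : Fin m) :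
    ∑ l, christoffel (inducedMetric Φ) i j l x * inducedMetric Φ x l t
      = inner ℝ (pd i (pd j Φ) x) (pd t Φ x) := by
  have hdet : IsUnit (inducedMetric Φ x).det :=
    isUnit_iff_ne_zero.mpr (inducedMetric_det_ne_zero (himm x hx))
  have hinv (h : Fin m) : ∑ l, (inducedMetric Φ x)⁻¹ h l * inducedMetric Φ x l t
      = if h = t then 1 else 0 := by
    rw [← Matrix.mul_apply, Matrix.nonsing_inv_mul _ hdet, Matrix.one_apply]
  -- Of the six inner products produced by the product rule, four cancel by symmetry of second
  -- derivatives and the other two coincide.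
  have hc (h : Fin m) : pd i (fun y => inducedMetric Φ y j h) x
      + pd j (fun y => inducedMetric Φ y h i) x - pd h (fun y => inducedMetric Φ y i j) x
      = 2 * inner ℝ (pd i (pd j Φ) x) (pd h Φ x) := by
    rw [pd_inducedMetric hU hΦ hx, pd_inducedMetric hU hΦ hx, pd_inducedMetric hU hΦ hx,
      pd_comm hU hΦ hx j h, pd_comm hU hΦ hx j i, pd_comm hU hΦ hx i h,
      real_inner_comm (pd j Φ x), real_inner_comm (pd h Φ x) (pd i (pd j Φ) x),
      real_inner_comm (pd i Φ x)]
    ring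
  simp only [christoffel, hc]
  calc _ = ∑ l, ∑ h, inner ℝ (pd i (pd j Φ) x) (pd h Φ x) *
        ((inducedMetric Φ x)⁻¹ h l * inducedMetric Φ x l t) := by
        refine Finset.sum_congr rfl fun l _ => ?_
        rw [Finset.mul_sum, Finset.sum_mul]
        exact Finset.sum_congr rfl fun h _ => by ring
    _ = _ := by
        rw [Finset.sum_comm]
        simp only [← Finset.mul_sum, hinv]
        simp

/-- The second fundamental form at `x` of the immersion `Φ`: the component of `D²Φ` normal to the
range of `DΦ`. -/
def secondFundamentalForm [FiniteDimensional ℝ V] (Φ : (Fin m → ℝ) → V) (x X Y : Fin m → ℝ) : V :=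
  ((fderiv ℝ Φ x).rangeᗮ).starProjection (fderiv ℝ (fderiv ℝ Φ) x X Y)

variable [FiniteDimensional ℝ V]

/-- The Gauss formula. The Christoffel combination is tangent, and what remains of `∂_i ∂_j Φ` is
orthogonal to every `∂_t Φ` by `sum_christoffel_mul_inducedMetric`; this characterizes the normal
projection. -/
theorem secondFundamentalForm_single (hU : IsOpen U) (hΦ : ContDiffOn ℝ ∞ Φ U)
    (himm : ∀ y ∈ U, Function.Injective (fderiv ℝ Φ y)) (hx : x ∈ U) (i j : Fin m) :
    secondFundamentalForm Φ x (Pi.single i 1) (Pi.single j 1)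
      = pd i (pd j Φ) x - ∑ l, christoffel (inducedMetric Φ) i j l x • pd l Φ x := by
  have hmem : ∑ l, christoffel (inducedMetric Φ) i j l x • pd l Φ x ∈ (fderiv ℝ Φ x).range :=
    ⟨fun l => christoffel (inducedMetric Φ) i j l x, fderiv_eq_sum_pd _ _⟩
  have horth : pd i (pd j Φ) x - ∑ l, christoffel (inducedMetric Φ) i j l x • pd l Φ x
      ∈ (fderiv ℝ Φ x).rangeᗮ := by
    rw [Submodule.mem_orthogonal']
    rintro _ ⟨v, rfl⟩
    have key (t : Fin m) : inner ℝ (pd i (pd j Φ) x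
        - ∑ l, christoffel (inducedMetric Φ) i j l x • pd l Φ x) (pd t Φ x) = 0 := by
      rw [inner_sub_left, sum_inner, ← sum_christoffel_mul_inducedMetric hU hΦ himm hx, sub_eq_zero]
      exact Finset.sum_congr rfl fun l _ => by rw [inner_smul_left]; rfl
    simp only [ContinuousLinearMap.coe_coe]
    rw [fderiv_eq_sum_pd, inner_sum]
    exact Finset.sum_eq_zero fun t _ => by rw [inner_smul_right, key, mul_zero]
  rw [secondFundamentalForm, ← pd_pd_eq_fderiv_fderiv hU hΦ hx]
  refine Submodule.eq_starProjection_of_mem_of_inner_eq_zero horth ?_ |>.symm ▸ rfl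
  intro w hw
  rw [sub_sub_cancel]
  exact (Submodule.mem_orthogonal _ _).mp hw _ hmem

theorem secondFundamentalForm_comm (hU : IsOpen U) (hΦ : ContDiffOn ℝ ∞ Φ U) (hx : x ∈ U)
    (X Y : Fin m → ℝ) : secondFundamentalForm Φ x X Y = secondFundamentalForm Φ x Y X := by
  rw [secondFundamentalForm, hΦ.fderiv_fderiv_comm hU hx, secondFundamentalForm]

theorem secondFundamentalForm_add_smul_left (a b : ℝ) (X Y Z : Fin m → ℝ) :
    secondFundamentalForm Φ x (a • X + b • Y) Z
      = a • secondFundamentalForm Φ x X Z + b • secondFundamentalForm Φ x Y Z := by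
  simp only [secondFundamentalForm, map_add, map_smul, add_apply, smul_apply]

theorem secondFundamentalForm_add_smul_right (a b : ℝ) (X Y Z : Fin m → ℝ) :
    secondFundamentalForm Φ x Z (a • X + b • Y)
      = a • secondFundamentalForm Φ x Z X + b • secondFundamentalForm Φ x Z Y := by
  simp only [secondFundamentalForm, map_add, map_smul]

theorem secondFundamentalForm_eq_sum (X Y : Fin m → ℝ) :
    secondFundamentalForm Φ x X Y = ∑ i, ∑ j, (X i * Y j) •
      secondFundamentalForm Φ x (Pi.single i 1) (Pi.single j 1) := by
  have hbasis (Z : Fin m → ℝ) : Z = ∑ i, Z i • (Pi.single i 1 : Fin m → ℝ) := by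
    ext j
    simp [Finset.sum_apply, Pi.single_apply]
  conv_lhs => rw [hbasis X, hbasis Y]
  simp only [secondFundamentalForm, map_sum, sum_apply, map_smul,
    smul_apply, Finset.smul_sum, smul_smul]
  rw [Finset.sum_comm]
  simp only [mul_comm]

/-- The derivative of the tangential part of `∂_i ∂_k Φ` along the surface. -/
theorem sum_pd_christoffel_mul_inducedMetric (hU : IsOpen U) (hΦ : ContDiffOn ℝ ∞ Φ U)
    (himm : ∀ y ∈ U, Function.Injective (fderiv ℝ Φ y)) (hx : x ∈ U) (i j k t : Fin m) :
    ∑ s, (∑ l, christoffel (inducedMetric Φ) i k l x * christoffel (inducedMetric Φ) j l s x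
        + pd j (christoffel (inducedMetric Φ) i k s) x) * inducedMetric Φ x s t
      = inner ℝ (pd j (pd i (pd k Φ)) x) (pd t Φ x)
        + inner ℝ (secondFundamentalForm Φ x (Pi.single i 1) (Pi.single k 1))
          (pd j (pd t Φ) x) := by
  have hΓ := contDiffOn_christoffel hU hΦ himm
  have hg := contDiffOn_inducedMetric hU hΦ
  -- The identity for the tangential part holds on all of `U`, so it may be differentiated in the
  -- direction `j`.
  have hdiff := pd_congr hU
    (fun y hy => sum_christoffel_mul_inducedMetric hU hΦ himm hy i k t) hx j
  rw [pd_sum_mul (fun l _ => (hΓ i k l).differentiableAt_of_isOpen hU hx)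
      (fun l _ => (hg l t).differentiableAt_of_isOpen hU hx),
    pd_inner (((hΦ.pd hU k).pd hU i).differentiableAt_of_isOpen hU hx)
      ((hΦ.pd hU t).differentiableAt_of_isOpen hU hx)] at hdiff
  simp only [pd_inducedMetric hU hΦ hx, Finset.sum_add_distrib, mul_add,
    ← sum_christoffel_mul_inducedMetric hU hΦ himm hx j _ t] at hdiff
  have hswap : ∑ s, (∑ l, christoffel (inducedMetric Φ) i k l x
      * christoffel (inducedMetric Φ) j l s x) * inducedMetric Φ x s t
      = ∑ l, christoffel (inducedMetric Φ) i k l x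
        * ∑ s, christoffel (inducedMetric Φ) j l s x * inducedMetric Φ x s t := by
    simp only [Finset.sum_mul, Finset.mul_sum]
    rw [Finset.sum_comm]
    simp only [mul_assoc]
  simp only [add_mul, Finset.sum_add_distrib, hswap]
  rw [secondFundamentalForm_single hU hΦ himm hx, inner_sub_left, sum_inner]
  simp only [inner_smul_left, RCLike.conj_to_real]
  linarith

/-- The Gauss equation in coordinates. -/
theorem sum_curvatureCoeff_mul_inducedMetric (hU : IsOpen U) (hΦ : ContDiffOn ℝ ∞ Φ U)
    (himm : ∀ y ∈ U, Function.Injective (fderiv ℝ Φ y)) (hx : x ∈ U) (i j k t : Fin m) :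
    ∑ s, curvatureCoeff (inducedMetric Φ) i j k s x * inducedMetric Φ x s t
      = inner ℝ (secondFundamentalForm Φ x (Pi.single i 1) (Pi.single k 1))
          (secondFundamentalForm Φ x (Pi.single j 1) (Pi.single t 1))
        - inner ℝ (secondFundamentalForm Φ x (Pi.single j 1) (Pi.single k 1))
          (secondFundamentalForm Φ x (Pi.single i 1) (Pi.single t 1)) := by
  -- A normal vector only sees the normal part of a second derivative.
  have hnormal (a b : Fin m) (v : V) (hv : v ∈ (fderiv ℝ Φ x).rangeᗮ) :
      inner ℝ v (pd a (pd b Φ) x)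
        = inner ℝ v (secondFundamentalForm Φ x (Pi.single a 1) (Pi.single b 1)) := by
    rw [secondFundamentalForm, ← Submodule.inner_starProjection_left_eq_right,
      Submodule.starProjection_eq_self_iff.mpr hv, pd_pd_eq_fderiv_fderiv hU hΦ hx]
  have hmem (a b : Fin m) : secondFundamentalForm Φ x (Pi.single a 1) (Pi.single b 1)
      ∈ (fderiv ℝ Φ x).rangeᗮ := Submodule.starProjection_apply_mem _ _
  have h₁ := sum_pd_christoffel_mul_inducedMetric hU hΦ himm hx i j k t
  have h₂ := sum_pd_christoffel_mul_inducedMetric hU hΦ himm hx j i k t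
  rw [hnormal _ _ _ (hmem _ _)] at h₁ h₂
  -- The third derivatives now agree, so they cancel in the difference antisymmetrized in `i` and
  -- `j`.
  rw [pd_comm hU (hΦ.pd hU k) hx] at h₂
  have hsub := congrArg₂ (· - ·) h₁ h₂
  simp only [← Finset.sum_sub_distrib, ← sub_mul] at hsub
  calc _ = _ := Finset.sum_congr rfl fun s _ => by unfold curvatureCoeff; congr 1; ring
    _ = _ := hsub
    _ = _ := by ring

/-- The Gauss equation. -/
theorem curvatureForm_inducedMetric (hU : IsOpen U) (hΦ : ContDiffOn ℝ ∞ Φ U)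
    (himm : ∀ y ∈ U, Function.Injective (fderiv ℝ Φ y)) (hx : x ∈ U) (X Y : Fin m → ℝ) :
    curvatureForm (inducedMetric Φ) x X Y
      = inner ℝ (secondFundamentalForm Φ x X X) (secondFundamentalForm Φ x Y Y)
        - inner ℝ (secondFundamentalForm Φ x X Y) (secondFundamentalForm Φ x X Y) := by
  have hexp (a b c d : Fin m → ℝ) :
      inner ℝ (secondFundamentalForm Φ x a b) (secondFundamentalForm Φ x c d)
        = ∑ i, ∑ k, ∑ j, ∑ t, a i * b k * (c j * d t)
          * inner ℝ (secondFundamentalForm Φ x (Pi.single i 1) (Pi.single k 1))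
            (secondFundamentalForm Φ x (Pi.single j 1) (Pi.single t 1)) := by
    rw [real_inner_comm, secondFundamentalForm_eq_sum a b, secondFundamentalForm_eq_sum c d]
    simp only [sum_inner, inner_sum, inner_smul_left, inner_smul_right, RCLike.conj_to_real,
      Finset.mul_sum]
    refine Finset.sum_congr rfl fun i _ => Finset.sum_congr rfl fun k _ =>
      Finset.sum_congr rfl fun j _ => Finset.sum_congr rfl fun t _ => ?_
    rw [real_inner_comm]
    ring
  -- One factor is turned around to match the index pattern `II_jk`, `II_it` of the coordinate Gauss
  -- equation, paired with `Y_j X_k` and `X_i Y_t`.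
  have h₂ : inner ℝ (secondFundamentalForm Φ x X Y) (secondFundamentalForm Φ x X Y)
      = inner ℝ (secondFundamentalForm Φ x Y X) (secondFundamentalForm Φ x X Y) := by
    rw [secondFundamentalForm_comm hU hΦ hx Y X]
  rw [h₂, hexp X X Y Y, hexp Y X X Y, curvatureForm]
  simp only [sum_curvatureCoeff_mul_inducedMetric hU hΦ himm hx, sub_mul,
    Finset.sum_sub_distrib]
  congr 1
  · refine Finset.sum_congr rfl fun i _ => ?_
    rw [Finset.sum_comm]
    refine Finset.sum_congr rfl fun k _ =>
      Finset.sum_congr rfl fun j _ => Finset.sum_congr rfl fun t _ => by ring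
  · rw [Finset.sum_comm]
    refine Finset.sum_congr rfl fun i _ => ?_
    rw [Finset.sum_comm]
    refine Finset.sum_congr rfl fun k _ =>
      Finset.sum_congr rfl fun j _ => Finset.sum_congr rfl fun t _ => by ring

end GaussEquation

/-! ### Lines in a submanifold and asymptotic directions -/

section RuledSubmanifolds

open Filter Topology

variable {m : ℕ} {V : Type*} [NormedAddCommGroup V] [InnerProductSpace ℝ V]
  [FiniteDimensional ℝ V] {N : Set V} {U : Set (Fin m → ℝ)} {Φ : (Fin m → ℝ) → V} {x : Fin m → ℝ}

/-- A straight line contained in `N` is, near `Φ x`, the image of a smooth curve. -/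
theorem IsParametrization.exists_curve (h : IsParametrization N U Φ) (hx : x ∈ U) (η : V)
    (hη : ∀ t : ℝ, Φ x + t • η ∈ N) :
    ∃ y : ℝ → Fin m → ℝ, ContDiffAt ℝ ∞ y 0 ∧ y 0 = x ∧
      ∀ᶠ t in 𝓝 (0 : ℝ), Φ (y t) = Φ x + t • η := by
  have hΦ : ContDiffAt ℝ ∞ Φ x := h.smooth.contDiffAt (h.isOpen.mem_nhds hx)
  -- With `q` a left inverse of `DΦ(x)`, the map `q ∘ Φ` has derivative the identity at `x`. Its
  -- local inverse applied to `q` of the line gives the curve.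
  obtain ⟨Q, hQ⟩ := LinearMap.exists_leftInverse_of_injective
    (fderiv ℝ Φ x : (Fin m → ℝ) →ₗ[ℝ] V) (LinearMap.ker_eq_bot.mpr (h.immersion x hx))
  set q : V →L[ℝ] (Fin m → ℝ) := LinearMap.toContinuousLinearMap Q with hq
  have hf : ContDiffAt ℝ ∞ (fun z => q (Φ z)) x := q.contDiff.contDiffAt.comp x hΦ
  have hf' : HasFDerivAt (fun z => q (Φ z))
      (ContinuousLinearEquiv.refl ℝ (Fin m → ℝ) : (Fin m → ℝ) →L[ℝ] (Fin m → ℝ)) x := by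
    have hcoe : (ContinuousLinearEquiv.refl ℝ (Fin m → ℝ) : (Fin m → ℝ) →L[ℝ] (Fin m → ℝ))
        = q ∘L fderiv ℝ Φ x :=
      ContinuousLinearMap.ext fun v => (LinearMap.congr_fun hQ v).symm
    rw [hcoe]
    exact q.hasFDerivAt.comp x (hΦ.differentiableAt (by simp)).hasFDerivAt
  set e := hf.toOpenPartialHomeomorph (fun z => q (Φ z)) hf' (by simp) with he
  have hecoe : ⇑e = fun z => q (Φ z) := hf.toOpenPartialHomeomorph_coe hf' (by simp)
  have hxe : x ∈ e.source := hf.mem_toOpenPartialHomeomorph_source hf' (by simp)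
  have hsymm : ContDiffAt ℝ ∞ e.symm (q (Φ x)) := hf.to_localInverse hf' (by simp)
  -- Points of `N` near `Φ x` must come from parameters where `e` is invertible; relative openness
  -- of the image of `U ∩ e.source` ensures this.
  obtain ⟨W, hW, hUW⟩ := h.open_image (U ∩ e.source) Set.inter_subset_left
    (h.isOpen.inter e.open_source)
  have hxW : Φ x ∈ W :=
    (hUW.subset (Set.mem_image_of_mem Φ ⟨hx, hxe⟩)).2
  have hline : ContDiff ℝ ∞ fun t : ℝ => q (Φ x + t • η) := by fun_prop
  refine ⟨fun t => e.symm (q (Φ x + t • η)), ?_, ?_, ?_⟩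
  · refine ContDiffAt.comp (0 : ℝ) (g := e.symm) ?_ hline.contDiffAt
    simpa using hsymm
  · have := e.left_inv hxe
    rw [hecoe] at this
    simpa using this
  · have hcont : ContinuousAt (fun t : ℝ => Φ x + t • η) 0 := by fun_prop
    have hev : ∀ᶠ t in 𝓝 (0 : ℝ), Φ x + t • η ∈ W :=
      hcont.eventually_mem (hW.mem_nhds (by simpa using hxW))
    filter_upwards [hev] with t ht
    obtain ⟨z, hz, hzt⟩ := hUW.symm.subset (⟨hη t, ht⟩ : Φ x + t • η ∈ N ∩ W)
    have := e.left_inv hz.2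
    rw [hecoe] at this
    simp only at this
    rw [← hzt, this]

/-- A straight line contained in a submanifold is tangent to an asymptotic direction. -/
theorem IsParametrization.exists_asymptotic_direction (h : IsParametrization N U Φ) (hx : x ∈ U)
    (η : V) (hη : ∀ t : ℝ, Φ x + t • η ∈ N) :
    ∃ v, fderiv ℝ Φ x v = η ∧ secondFundamentalForm Φ x v v = 0 := by
  obtain ⟨y, hy, hy0, hyη⟩ := h.exists_curve hx η hη
  have hy1 : ContDiffAt ℝ 1 y 0 := hy.of_le (WithTop.coe_le_coe.mpr le_top)
  have hU : ∀ᶠ t in 𝓝 (0 : ℝ), y t ∈ U :=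
    hy.continuousAt.eventually_mem (h.isOpen.mem_nhds (hy0 ▸ hx))
  have hderiv : ∀ᶠ t in 𝓝 (0 : ℝ), fderiv ℝ Φ (y t) (fderiv ℝ y t 1) = η := by
    filter_upwards [hyη.eventually_nhds, hU, hy1.eventually (by simp)] with t ht htU hyt
    have h₁ := ((h.smooth.differentiableAt_of_isOpen h.isOpen htU).hasFDerivAt.comp_hasDerivAt t
      (hyt.differentiableAt (by simp)).hasFDerivAt.hasDerivAt)
    have h₂ : HasDerivAt (fun t : ℝ => Φ x + t • η) η t := by
      simpa using ((hasDerivAt_id t).smul_const η).const_add (Φ x)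
    exact h₁.unique (h₂.congr_of_eventuallyEq ht)
  have hD : HasFDerivAt (fderiv ℝ Φ) (fderiv ℝ (fderiv ℝ Φ) x) (y 0) := by
    rw [hy0]
    exact ((h.smooth.fderiv_of_isOpen h.isOpen (m := ∞) (by simp)).differentiableAt_of_isOpen
      h.isOpen hx).hasFDerivAt
  have hy' : HasDerivAt y (fderiv ℝ y 0 1) 0 :=
    (hy.differentiableAt (by simp)).hasFDerivAt.hasDerivAt
  have hfy : DifferentiableAt ℝ (fun t => fderiv ℝ y t 1) 0 :=
    ((hy.fderiv_right (m := ∞) (by simp)).differentiableAt (by simp)).clm_apply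
      (differentiableAt_const _)
  -- Second derivative of `Φ (y t) = Φ x + t • η` at `0`: `D²Φ(y', y') + DΦ(y'') = 0`, so `D²Φ(y',
  -- y')` is tangent and its normal part vanishes.
  have hsecond := (hD.comp_hasDerivAt (0 : ℝ) hy').clm_apply hfy.hasDerivAt
  have hzero := hsecond.unique ((hasDerivAt_const (0 : ℝ) η).congr_of_eventuallyEq hderiv)
  refine ⟨fderiv ℝ y 0 1, ?_, ?_⟩
  · simpa [hy0] using hderiv.self_of_nhds
  · rw [secondFundamentalForm, Submodule.starProjection_apply_eq_zero_iff,
      Submodule.orthogonal_orthogonal, eq_neg_of_add_eq_zero_left hzero, ← map_neg]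
    simp only [Function.comp_apply, hy0]
    exact ⟨_, rfl⟩

/-- If the plane spanned by `X` and `Y` contains an asymptotic direction, its sectional curvature
is non-positive. -/
theorem sectionalCurvature_nonpos_of_asymptotic (hU : IsOpen U) (hΦ : ContDiffOn ℝ ∞ Φ U)
    (himm : ∀ y ∈ U, Function.Injective (fderiv ℝ Φ y)) (hx : x ∈ U) {X Y : Fin m → ℝ} {a b : ℝ}
    (hab : a ≠ 0 ∨ b ≠ 0)
    (hzero : secondFundamentalForm Φ x (a • X + b • Y) (a • X + b • Y) = 0) :
    sectionalCurvature (inducedMetric Φ) x X Y ≤ 0 := by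
  refine div_nonpos_of_nonpos_of_nonneg ?_ ?_
  · rw [curvatureForm_inducedMetric hU hΦ himm hx]
    rw [secondFundamentalForm_add_smul_left, secondFundamentalForm_add_smul_right,
      secondFundamentalForm_add_smul_right, secondFundamentalForm_comm hU hΦ hx Y X] at hzero
    set A := secondFundamentalForm Φ x X X
    set B := secondFundamentalForm Φ x X Y
    set C := secondFundamentalForm Φ x Y Y
    have hA : a ^ 2 * inner ℝ A A + 2 * a * b * inner ℝ A B + b ^ 2 * inner ℝ A C = 0 := by
      have := congrArg (inner ℝ A) hzero
      simp only [inner_add_right, inner_smul_right, inner_zero_right] at this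
      linarith
    have hC : a ^ 2 * inner ℝ A C + 2 * a * b * inner ℝ B C + b ^ 2 * inner ℝ C C = 0 := by
      have := congrArg (inner ℝ C) hzero
      simp only [inner_add_right, inner_smul_right, inner_zero_right] at this
      rw [real_inner_comm A C, real_inner_comm B C] at this
      linarith
    -- By `hC` and `hA` these two squared norms equal `a² (|B|² - ⟨A, C⟩)` and `b² (|B|² - ⟨A, C⟩)`;
    -- adding them avoids a case split on which coefficient is nonzero.
    have h₁ : 0 ≤ inner ℝ (a • B + b • C) (a • B + b • C) := real_inner_self_nonneg
    have h₂ : 0 ≤ inner ℝ (a • A + b • B) (a • A + b • B) := real_inner_self_nonneg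
    simp only [inner_add_left, inner_add_right, real_inner_smul_left, real_inner_smul_right,
      real_inner_comm B C, real_inner_comm A B] at h₁ h₂
    have hpos : 0 < a ^ 2 + b ^ 2 := by
      rcases hab with h | h <;> positivity
    refine nonpos_of_mul_nonpos_right ?_ hpos
    linarith
  · rw [← inner_fderiv_eq_metricInner, ← inner_fderiv_eq_metricInner,
      ← inner_fderiv_eq_metricInner, sub_nonneg, sq]
    exact real_inner_mul_inner_self_le _ _

end RuledSubmanifolds

/-! ### Inverse functions and regular level sets -/

section RegularLevelSets

open Filter Topology

/-- The inverse function theorem, for a smooth map between spaces of the same dimension. -/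
theorem ContDiffOn.exists_openPartialHomeomorph {E F : Type*} [NormedAddCommGroup E]
    [NormedSpace ℝ E] [FiniteDimensional ℝ E] [NormedAddCommGroup F] [NormedSpace ℝ F]
    [FiniteDimensional ℝ F] (hdim : Module.finrank ℝ E = Module.finrank ℝ F) {f : E → F}
    {O : Set E} (hO : IsOpen O) (hf : ContDiffOn ℝ ∞ f O) {z : E} (hz : z ∈ O)
    (hinj : Function.Injective (fderiv ℝ f z)) :
    ∃ e : OpenPartialHomeomorph E F, ⇑e = f ∧ z ∈ e.source ∧ e.source ⊆ O ∧
      ContDiffOn ℝ ∞ e.symm e.target := by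
  have hfz : ContDiffAt ℝ ∞ f z := hf.contDiffAt (hO.mem_nhds hz)
  set f' : E ≃L[ℝ] F := (LinearEquiv.ofInjectiveOfFinrankEq
    (fderiv ℝ f z : E →ₗ[ℝ] F) hinj hdim).toContinuousLinearEquiv with hf'
  have hcoe : (f' : E →L[ℝ] F) = fderiv ℝ f z := ContinuousLinearMap.ext fun v => rfl
  have hder : HasFDerivAt f (f' : E →L[ℝ] F) z := by
    rw [hcoe]
    exact (hfz.differentiableAt (by simp)).hasFDerivAt
  set e₀ := hfz.toOpenPartialHomeomorph f hder (by simp)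
  have he₀ : ⇑e₀ = f := hfz.toOpenPartialHomeomorph_coe hder (by simp)
  -- Restricting to points with invertible derivative makes the inverse smooth on the whole target,
  -- not only at the image of `z`.
  set A : Set E := O ∩ fderiv ℝ f ⁻¹' Set.range ((↑) : (E ≃L[ℝ] F) → E →L[ℝ] F)
  have hA : IsOpen A := (hf.fderiv_of_isOpen hO (m := ∞) (by simp)).continuousOn.isOpen_inter_preimage
    hO ContinuousLinearEquiv.isOpen
  have hzA : z ∈ A := ⟨hz, f', hcoe⟩
  refine ⟨e₀.restrOpen A hA, ?_, ?_, ?_, ?_⟩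
  · simpa using he₀
  · rw [OpenPartialHomeomorph.restrOpen_source]
    exact ⟨hfz.mem_toOpenPartialHomeomorph_source hder (by simp), hzA⟩
  · rw [OpenPartialHomeomorph.restrOpen_source]
    exact fun w hw => hw.2.1
  · intro w hw
    have hsource := (e₀.restrOpen A hA).map_target hw
    rw [OpenPartialHomeomorph.restrOpen_source] at hsource
    obtain ⟨hwO, g, hg⟩ := hsource.2
    have hfw := hf.contDiffAt (hO.mem_nhds hwO)
    have hcoe' : ⇑(e₀.restrOpen A hA) = f := by simpa using he₀
    refine ((e₀.restrOpen A hA).contDiffAt_symm (f₀' := g) hw ?_ ?_).contDiffWithinAt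
    · rw [hcoe', hg]
      exact (hfw.differentiableAt (by simp)).hasFDerivAt
    · rw [hcoe']
      exact hfw

/-- A subset that is locally a regular level set is a submanifold. -/
theorem isSubmanifold_of_regular_level_set {V Y : Type*} [NormedAddCommGroup V]
    [InnerProductSpace ℝ V] [FiniteDimensional ℝ V] [NormedAddCommGroup Y] [NormedSpace ℝ Y]
    [FiniteDimensional ℝ Y] {m : ℕ} (hdim : Module.finrank ℝ V = Module.finrank ℝ Y + m)
    {N : Set V} (h : ∀ z ∈ N, ∃ O : Set V, IsOpen O ∧ z ∈ O ∧ ∃ H : V → Y, ContDiffOn ℝ ∞ H O ∧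
      (∀ w ∈ O, w ∈ N ↔ H w = 0) ∧ Function.Surjective (fderiv ℝ H z)) :
    IsSubmanifold m N := by
  intro z hz
  obtain ⟨O, hO, hzO, H, hH, hN, hsurj⟩ := h z hz
  set H' : V →ₗ[ℝ] Y := (fderiv ℝ H z : V →ₗ[ℝ] Y) with hH'
  have hker : Module.finrank ℝ H'.ker = Module.finrank ℝ (Fin m → ℝ) := by
    have := H'.finrank_range_add_finrank_ker
    rw [LinearMap.range_eq_top.mpr hsurj, finrank_top] at this
    rw [Module.finrank_fin_fun]
    omega
  -- `L` is a projection onto the kernel of `DH(z)`, identified with `ℝ^m`. It completes `H` to a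
  -- local diffeomorphism `(H, L)`, whose inverse on the slice `H = 0` is the parametrization.
  obtain ⟨P, hP⟩ := H'.ker.subtype.exists_leftInverse_of_injective (Submodule.ker_subtype _)
  set L : V →L[ℝ] (Fin m → ℝ) := LinearMap.toContinuousLinearMap
    ((LinearEquiv.ofFinrankEq _ _ hker).toLinearMap ∘ₗ P) with hL
  have hLinj (v : V) (hv : H' v = 0) (hLv : L v = 0) : v = 0 := by
    have hPv : P v = 0 := by
      have : (LinearEquiv.ofFinrankEq _ _ hker) (P v) = 0 := hLv
      simpa using this
    have := LinearMap.congr_fun hP ⟨v, hv⟩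
    simp only [LinearMap.comp_apply, Submodule.subtype_apply, LinearMap.id_apply, hPv] at this
    exact (congrArg Subtype.val this).symm
  have hK : ContDiffOn ℝ ∞ (fun w => (H w, L w)) O := hH.prodMk L.contDiff.contDiffOn
  have hKinj : Function.Injective (fderiv ℝ (fun w => (H w, L w)) z) := by
    rw [((hH.differentiableAt_of_isOpen hO hzO).hasFDerivAt.prodMk L.hasFDerivAt).fderiv]
    refine (injective_iff_map_eq_zero _).mpr fun v hv => ?_
    exact hLinj v (congrArg Prod.fst hv) (congrArg Prod.snd hv)
  obtain ⟨e, he, hze, heO, hesymm⟩ := hK.exists_openPartialHomeomorph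
    (by rw [Module.finrank_prod, hdim, Module.finrank_fin_fun]) hO hzO hKinj
  have hmem {w : V} (hw : w ∈ e.source) : w ∈ N ↔ H w = 0 := hN w (heO hw)
  set U : Set (Fin m → ℝ) := {y | ((0 : Y), y) ∈ e.target} with hUdef
  have hinv {y : Fin m → ℝ} (hy : y ∈ U) :
      H (e.symm (0, y)) = 0 ∧ L (e.symm (0, y)) = y := by
    have := e.right_inv hy
    rw [he] at this
    exact ⟨congrArg Prod.fst this, congrArg Prod.snd this⟩
  have hU : IsOpen U := e.open_target.preimage (by fun_prop)
  have hΦ : ContDiffOn ℝ ∞ (fun y : Fin m → ℝ => e.symm (0, y)) U :=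
    hesymm.comp (contDiffOn_const.prodMk contDiffOn_id) fun y hy => hy
  have hez {w : V} (hw : H w = 0) : e w = (0, L w) := by
    rw [he]
    exact congrArg (·, L w) hw
  refine ⟨U, fun y => e.symm (0, y), ⟨hU, hΦ, fun y hy => ?_, fun y hy y' hy' hyy' => ?_,
    fun U' hU'U hU' => ?_⟩, L z, ?_, ?_⟩
  · have hcomp := L.hasFDerivAt.comp y (hΦ.differentiableAt_of_isOpen hU hy).hasFDerivAt
    have hid : HasFDerivAt (fun y : Fin m → ℝ => y)
        (L ∘L fderiv ℝ (fun y : Fin m → ℝ => e.symm (0, y)) y) y :=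
      hcomp.congr_of_eventuallyEq
        (eventuallyEq_of_mem (hU.mem_nhds hy) fun w hw => (hinv hw).2.symm)
    have := hid.unique (hasFDerivAt_id y)
    refine Function.LeftInverse.injective (g := L) fun v => ?_
    exact DFunLike.congr_fun this v
  · rw [← (hinv hy).2, ← (hinv hy').2, hyy']
  · refine ⟨e.source ∩ e ⁻¹' (Set.univ ×ˢ U'), e.isOpen_inter_preimage (isOpen_univ.prod hU'), ?_⟩
    ext w
    constructor
    · rintro ⟨y, hy, rfl⟩
      have hs := e.map_target (hU'U hy)
      refine ⟨(hmem hs).mpr (hinv (hU'U hy)).1, hs, ?_⟩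
      rw [Set.mem_preimage, e.right_inv (hU'U hy)]
      exact ⟨trivial, hy⟩
    · rintro ⟨hwN, hws, hwU⟩
      rw [Set.mem_preimage, hez ((hmem hws).mp hwN)] at hwU
      refine ⟨L w, hwU.2, ?_⟩
      simp only
      rw [← hez ((hmem hws).mp hwN), e.left_inv hws]
  · have := e.map_source hze
    rwa [hez ((hmem hze).mp hz)] at this
  · simp only
    rw [← hez ((hmem hze).mp hz), e.left_inv hze]

end RegularLevelSets

/-! ### Marginal rates of substitution and demand -/

namespace SmoothConsumer

open Filter Topology

variable {n : ℕ} (c : SmoothConsumer n)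

/-- The normalized price vector with the relative prices `q`. -/
def _root_.withNumeraire (q : Fin n → ℝ) : GoodsVec n := Fin.snoc (α := fun _ => ℝ) q 1

theorem _root_.withNumeraire_dotProduct (q : Fin n → ℝ) (v : GoodsVec n) :
    withNumeraire q ⬝ᵥ v = ∑ l, q l * v l.castSucc + v (Fin.last n) := by
  simp [withNumeraire, dotProduct, Fin.sum_univ_castSucc]

/-- The marginal utility of a good. -/
def marginalUtility (l : Fin (n + 1)) (x : GoodsVec n) : ℝ := fderiv ℝ c.u x (Pi.single l 1)

/-- The marginal rates of substitution between the goods and the numeraire. -/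
def mrs (x : GoodsVec n) : Fin n → ℝ :=
  fun l => c.marginalUtility l.castSucc x / c.marginalUtility (Fin.last n) x

variable {c} {x y : GoodsVec n}

theorem differentiableAt_u (hx : x ∈ c.X) : DifferentiableAt ℝ c.u x :=
  c.smooth.differentiableAt_of_isOpen c.isOpen_X hx

theorem differentiableAt_fderiv_u (hx : x ∈ c.X) : DifferentiableAt ℝ (fderiv ℝ c.u) x :=
  (c.smooth.fderiv_of_isOpen c.isOpen_X (m := ∞) (by simp)).differentiableAt_of_isOpen
    c.isOpen_X hx

theorem contDiffOn_marginalUtility (l : Fin (n + 1)) :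
    ContDiffOn ℝ ∞ (c.marginalUtility l) c.X :=
  (c.smooth.fderiv_of_isOpen c.isOpen_X (by simp)).clm_apply contDiffOn_const

theorem marginalUtility_pos (hx : x ∈ c.X) (l : Fin (n + 1)) : 0 < c.marginalUtility l x :=
  c.monotone x hx l

theorem contDiffOn_mrs : ContDiffOn ℝ ∞ c.mrs c.X :=
  contDiffOn_pi.mpr fun _ => (contDiffOn_marginalUtility _).div (contDiffOn_marginalUtility _)
    fun _ hx => (marginalUtility_pos hx _).ne'

theorem mrs_pos (hx : x ∈ c.X) (l : Fin n) : 0 < c.mrs x l :=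
  div_pos (marginalUtility_pos hx _) (marginalUtility_pos hx _)

theorem fderiv_u_eq (hx : x ∈ c.X) (v : GoodsVec n) :
    fderiv ℝ c.u x v
      = c.marginalUtility (Fin.last n) x * (withNumeraire (c.mrs x) ⬝ᵥ v) := by
  have hsum : fderiv ℝ c.u x v = ∑ l, v l * c.marginalUtility l x := by
    simpa [pd, marginalUtility] using fderiv_eq_sum_pd (Φ := c.u) x v
  have hne := (marginalUtility_pos hx (Fin.last n)).ne'
  rw [hsum, withNumeraire_dotProduct, Fin.sum_univ_castSucc, mul_add, Finset.mul_sum]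
  congr 1
  · refine Finset.sum_congr rfl fun l _ => ?_
    rw [mrs]
    field_simp
  · ring

/-- Along the hyperplane of net trades of value zero, the derivative of the marginal rates of
substitution is negative definite. -/
theorem fderiv_mrs_dotProduct_neg (hx : x ∈ c.X) {v : GoodsVec n} (hv : v ≠ 0)
    (hpv : withNumeraire (c.mrs x) ⬝ᵥ v = 0) :
    ∑ l, fderiv ℝ c.mrs x v l * v l.castSucc < 0 := by
  have hmrs : HasFDerivAt c.mrs (fderiv ℝ c.mrs x) x :=
    (contDiffOn_mrs.differentiableAt_of_isOpen c.isOpen_X hx).hasFDerivAt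
  have hval : HasFDerivAt (fun y => withNumeraire (c.mrs y) ⬝ᵥ v)
      (∑ l : Fin n, v l.castSucc •
        ((ContinuousLinearMap.proj l).comp (fderiv ℝ c.mrs x) : GoodsVec n →L[ℝ] ℝ)) x := by
    simp only [withNumeraire_dotProduct]
    exact (HasFDerivAt.fun_sum fun l _ => (hasFDerivAt_pi'.mp hmrs l).mul_const _).add_const _
  have hmarg := ((contDiffOn_marginalUtility (c := c)
    (Fin.last n)).differentiableAt_of_isOpen c.isOpen_X hx).hasFDerivAt
  -- Differentiate `Du(y) v = u_L(y) · ((mrs y, 1) · v)` along `v`. The term containing the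
  -- derivative of `u_L` is multiplied by `(mrs x, 1) · v = 0`.
  have h₁ := (hmarg.mul hval).congr_of_eventuallyEq
    (eventuallyEq_of_mem (c.isOpen_X.mem_nhds hx) fun y hy => fderiv_u_eq hy v)
  have h₂ := (differentiableAt_fderiv_u hx).hasFDerivAt.clm_apply (hasFDerivAt_const v x)
  have h := DFunLike.congr_fun (h₂.unique h₁) v
  simp only [hpv, add_apply, smul_apply, sum_apply, ContinuousLinearMap.comp_apply,
    ContinuousLinearMap.proj_apply, ContinuousLinearMap.flip_apply, smul_eq_mul, zero_mul,
    add_zero, zero_apply, map_zero, zero_add] at h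
  have hneg := c.quasiconcave x hx v hv (by rw [fderiv_u_eq hx, hpv, mul_zero])
  rw [h] at hneg
  have := neg_of_mul_neg_right hneg (marginalUtility_pos hx (Fin.last n)).le
  calc _ = _ := Finset.sum_congr rfl fun l _ => mul_comm _ _
    _ < 0 := this

/-- Moving in a direction in which utility does not increase to first order, utility does not
increase, and it strictly decreases unless there is no move. -/
theorem u_le_of_fderiv_nonpos (hx : x ∈ c.X) (hy : y ∈ c.X)
    (hxy : fderiv ℝ c.u x (y - x) ≤ 0) : c.u y ≤ c.u x ∧ (c.u y = c.u x → y = x) := by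
  by_cases hne : y = x
  · simp [hne]
  set d := y - x with hd
  have hd0 : d ≠ 0 := sub_ne_zero.mpr hne
  have hmem {t : ℝ} (ht : t ∈ Set.Icc (0 : ℝ) 1) : x + t • d ∈ c.X :=
    c.convex_X.add_smul_sub_mem hx hy ht
  clear_value d
  have hline (t : ℝ) : HasDerivAt (fun t : ℝ => x + t • d) d t := by
    simpa using ((hasDerivAt_id t).smul_const d).const_add x
  have hφ {t : ℝ} (ht : t ∈ Set.Icc (0 : ℝ) 1) :
      HasDerivAt (fun t : ℝ => c.u (x + t • d)) (fderiv ℝ c.u (x + t • d) d) t :=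
    (differentiableAt_u (hmem ht)).hasFDerivAt.comp_hasDerivAt t (hline t)
  have hψ {t : ℝ} (ht : t ∈ Set.Icc (0 : ℝ) 1) :
      HasDerivAt (fun t : ℝ => fderiv ℝ c.u (x + t • d) d)
        (fderiv ℝ (fderiv ℝ c.u) (x + t • d) d d) t := by
    have hD : HasDerivAt (fun t : ℝ => fderiv ℝ c.u (x + t • d))
        (fderiv ℝ (fderiv ℝ c.u) (x + t • d) d) t :=
      (differentiableAt_fderiv_u (hmem ht)).hasFDerivAt.comp_hasDerivAt t (hline t)
    have := hD.clm_apply (hasDerivAt_const t d)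
    rwa [map_zero, add_zero] at this
  -- Barrier argument: the slope of utility along the segment starts nonpositive, and wherever it is
  -- zero quasi-concavity makes its derivative negative, so it cannot cross zero.
  have hψ_nonpos : ∀ t ∈ Set.Icc (0 : ℝ) 1, fderiv ℝ c.u (x + t • d) d ≤ 0 := by
    refine fun t ht => image_le_of_deriv_right_lt_deriv_boundary (B := fun _ => 0)
      (B' := fun _ => 0) (fun t ht => (hψ ht).continuousAt.continuousWithinAt)
      (fun t ht => (hψ (Set.Ico_subset_Icc_self ht)).hasDerivWithinAt) ?_
      (fun _ => hasDerivAt_const _ _) (fun t ht h0 => ?_) ht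
    · simpa using hxy
    · exact c.quasiconcave _ (hmem (Set.Ico_subset_Icc_self ht)) d hd0 h0
  have hanti : AntitoneOn (fun t : ℝ => c.u (x + t • d)) (Set.Icc 0 1) := by
    refine antitoneOn_of_deriv_nonpos (convex_Icc 0 1)
      (fun t ht => (hφ ht).continuousAt.continuousWithinAt)
      (fun t ht => (hφ (interior_subset ht)).differentiableAt.differentiableWithinAt)
      fun t ht => ?_
    rw [(hφ (interior_subset ht)).deriv]
    exact hψ_nonpos t (interior_subset ht)
  have h1 : x + (1 : ℝ) • d = y := by simp [hd]
  have h0 : x + (0 : ℝ) • d = x := by simp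
  constructor
  · have := hanti (Set.left_mem_Icc.mpr zero_le_one) (Set.right_mem_Icc.mpr zero_le_one) zero_le_one
    simpa only [h1, h0] using this
  · intro heq
    exfalso
    -- Equal end values make utility constant on the segment. Its slope then vanishes there, and so
    -- does its second derivative at the midpoint, against quasi-concavity.
    have hconst : ∀ t ∈ Set.Icc (0 : ℝ) 1, c.u (x + t • d) = c.u x := fun t ht => by
      have ha := hanti (Set.left_mem_Icc.mpr zero_le_one) ht ht.1
      have hb := hanti ht (Set.right_mem_Icc.mpr zero_le_one) ht.2
      simp only [h1, h0] at ha hb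
      exact le_antisymm ha (heq ▸ hb)
    have hψ_zero : ∀ t ∈ Set.Ioo (0 : ℝ) 1, fderiv ℝ c.u (x + t • d) d = 0 := fun t ht =>
      (hφ (Set.Ioo_subset_Icc_self ht)).unique ((hasDerivAt_const t (c.u x)).congr_of_eventuallyEq
        (eventuallyEq_of_mem (Icc_mem_nhds ht.1 ht.2) hconst))
    have hhalf : (1 / 2 : ℝ) ∈ Set.Ioo (0 : ℝ) 1 := by norm_num
    have hzero := (hψ (Set.Ioo_subset_Icc_self hhalf)).unique
      ((hasDerivAt_const (1 / 2 : ℝ) (0 : ℝ)).congr_of_eventuallyEq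
        (eventuallyEq_of_mem (Ioo_mem_nhds hhalf.1 hhalf.2) hψ_zero))
    exact (c.quasiconcave _ (hmem (Set.Ioo_subset_Icc_self hhalf)) d hd0
      (hψ_zero _ hhalf)).ne hzero

/-- Each bundle lies on the supporting budget hyperplane of the other, so neither has the higher
utility, and equal utilities force equal bundles. -/
theorem eq_of_mrs_eq (hx : x ∈ c.X) (hy : y ∈ c.X) (hmrs : c.mrs x = c.mrs y)
    (hval : withNumeraire (c.mrs x) ⬝ᵥ x = withNumeraire (c.mrs x) ⬝ᵥ y) : x = y := by
  have h₁ := u_le_of_fderiv_nonpos hy hx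
    (by rw [fderiv_u_eq hy, dotProduct_sub, ← hmrs, hval, sub_self, mul_zero])
  have h₂ := u_le_of_fderiv_nonpos hx hy
    (by rw [fderiv_u_eq hx, dotProduct_sub, hval, sub_self, mul_zero])
  exact h₁.2 (le_antisymm h₁.1 h₂.1)

/-- The first order conditions characterize demand. -/
theorem isDemand_withNumeraire_iff {q : Fin n → ℝ} {w : ℝ} :
    IsDemand c (withNumeraire q) w x
      ↔ x ∈ c.X ∧ withNumeraire q ⬝ᵥ x = w ∧ c.mrs x = q := by
  constructor
  · rintro ⟨⟨hx, hw⟩, hmax⟩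
    have hbind : withNumeraire q ⬝ᵥ x = w := by
      refine hw.eq_of_not_lt fun hlt => ?_
      have hcont : Continuous fun y : GoodsVec n => withNumeraire q ⬝ᵥ y := by
        unfold dotProduct; fun_prop
      have hloc : IsLocalMax c.u x := by
        filter_upwards [c.isOpen_X.mem_nhds hx, hcont.continuousAt.eventually_lt
          continuousAt_const hlt] with y hy hyw using hmax y hy hyw.le
      have := marginalUtility_pos hx (Fin.last n)
      simp [marginalUtility, hloc.fderiv_eq_zero] at this
    refine ⟨hx, hbind, ?_⟩
    have hcrit (v : GoodsVec n) (hv : withNumeraire q ⬝ᵥ v = 0) : fderiv ℝ c.u x v = 0 := by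
      have hline : HasDerivAt (fun t : ℝ => x + t • v) v 0 := by
        simpa using ((hasDerivAt_id (0 : ℝ)).smul_const v).const_add x
      have hu : HasFDerivAt c.u (fderiv ℝ c.u x) (x + (0 : ℝ) • v) := by
        simpa using (differentiableAt_u hx).hasFDerivAt
      refine IsLocalMax.hasDerivAt_eq_zero (f := fun t : ℝ => c.u (x + t • v)) (a := 0) ?_
        (hu.comp_hasDerivAt (0 : ℝ) hline)
      filter_upwards [hline.continuousAt.eventually_mem
        (c.isOpen_X.mem_nhds (show x + (0 : ℝ) • v ∈ c.X by simpa using hx))] with t ht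
      simpa using hmax _ ht (by rw [dotProduct_add, dotProduct_smul, hv]; simpa using hw)
    funext l
    -- The test direction buys one unit of good `l` for `q l` units of the numeraire.
    have h := hcrit (Pi.single l.castSucc 1 - q l • Pi.single (Fin.last n) 1) (by
      simp [dotProduct_sub, withNumeraire])
    rw [map_sub, map_smul, smul_eq_mul] at h
    exact (div_eq_iff (marginalUtility_pos hx _).ne').mpr (sub_eq_zero.mp h)
  · rintro ⟨hx, rfl, rfl⟩
    refine ⟨⟨hx, le_rfl⟩, fun y hy hyx => (u_le_of_fderiv_nonpos hx hy ?_).1⟩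
    rw [fderiv_u_eq hx, dotProduct_sub]
    exact mul_nonpos_of_nonneg_of_nonpos (marginalUtility_pos hx _).le (sub_nonpos.mpr hyx)

end SmoothConsumer

/-! ### The equilibrium manifold: coordinates, regularity and ruling -/

section EquilibriumManifold

open Filter Topology

variable {n : ℕ}

/-- The net trade of value zero at the relative prices `q` with the given components other than
the numeraire. -/
def netTrade (q s : Fin n → ℝ) : GoodsVec n :=
  Fin.snoc (α := fun _ => ℝ) s (-∑ l, q l * s l)

@[simp]
theorem netTrade_castSucc (q s : Fin n → ℝ) (l : Fin n) : netTrade q s l.castSucc = s l := by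
  simp [netTrade]

@[simp]
theorem netTrade_last (q s : Fin n → ℝ) : netTrade q s (Fin.last n) = -∑ l, q l * s l := by
  simp [netTrade]

theorem netTrade_injective (q : Fin n → ℝ) : Function.Injective (netTrade q) := fun s t h =>
  funext fun l => by simpa using congrFun h l.castSucc

@[simp]
theorem withNumeraire_dotProduct_netTrade (q s : Fin n → ℝ) :
    withNumeraire q ⬝ᵥ netTrade q s = 0 := by
  simp [withNumeraire_dotProduct]

theorem netTrade_eq_self {q : Fin n → ℝ} {v : GoodsVec n} (hv : withNumeraire q ⬝ᵥ v = 0) :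
    netTrade q (fun l => v l.castSucc) = v := by
  funext l
  refine Fin.lastCases ?_ (fun l => ?_) l
  · rw [withNumeraire_dotProduct] at hv
    rw [netTrade_last]
    linarith
  · simp

/-- The net trades of value zero, as a linear function of their components other than the
numeraire. -/
def netTradeLinear (q : Fin n → ℝ) : (Fin n → ℝ) →ₗ[ℝ] GoodsVec n where
  toFun := netTrade q
  map_add' s t := by
    funext l
    refine Fin.lastCases ?_ (fun l => ?_) l <;>
    simp [mul_add, Finset.sum_add_distrib]
    ring
  map_smul' a s := by
    funext l
    refine Fin.lastCases ?_ (fun l => ?_) l <;>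
    simp [Finset.mul_sum, mul_left_comm]

variable (c : Fin 2 → SmoothConsumer n) (r : GoodsVec n)

/-- The feasible bundles of the first consumer: those which leave a bundle in its consumption set
to the second consumer. -/
def feasibleBundles : Set (GoodsVec n) := {x | x ∈ (c 0).X ∧ r - x ∈ (c 1).X}

/-- The difference between the marginal rates of substitution of the two consumers at the
allocation that gives `x` to the first one. -/
def mrsGap (x : GoodsVec n) : Fin n → ℝ := (c 0).mrs x - (c 1).mrs (r - x)

/-- The point of the ambient space determined by the bundle demanded by the first consumer and by
the components of its net trade other than the numeraire. -/
def pointOf (a : GoodsVec n × (Fin n → ℝ)) : Ambient n :=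
  WithLp.toLp 2 (Sum.elim ((c 0).mrs a.1) (a.1 + netTrade ((c 0).mrs a.1) a.2))

variable {c r}

theorem isOpen_feasibleBundles : IsOpen (feasibleBundles c r) :=
  (c 0).isOpen_X.inter ((c 1).isOpen_X.preimage (by fun_prop))

theorem contDiffOn_mrsGap : ContDiffOn ℝ ∞ (mrsGap c r) (feasibleBundles c r) :=
  (SmoothConsumer.contDiffOn_mrs.mono fun _ hx => hx.1).sub
    (SmoothConsumer.contDiffOn_mrs.comp (by fun_prop : ContDiff ℝ ∞ fun x => r - x).contDiffOn
      fun _ hx => hx.2)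

/-- Market clearing makes `r - x` the second bundle, whose budget equation follows from that of the
first. Positivity of prices is automatic, since they are marginal rates of substitution. -/
theorem mem_equilibriumManifold_iff {z : Ambient n} :
    z ∈ equilibriumManifold c r ↔ ∃ x ∈ feasibleBundles c r, mrsGap c r x = 0 ∧
      (c 0).mrs x = (fun l => z (Sum.inl l)) ∧
      priceOf z ⬝ᵥ x = priceOf z ⬝ᵥ endowmentOf z := by
  have hprice : priceOf z = withNumeraire fun l => z (Sum.inl l) := rfl
  constructor
  · rintro ⟨-, x, hx, hsum⟩
    have h0 := hx 0
    have h1 := hx 1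
    simp only [Fin.sum_univ_two, Matrix.cons_val_zero, Matrix.cons_val_one] at hsum h0 h1
    rw [hprice, SmoothConsumer.isDemand_withNumeraire_iff] at h0 h1
    have hx1 : r - x 0 = x 1 := by
      rw [add_sub_cancel, sub_eq_zero] at hsum
      rw [← hsum, add_sub_cancel_left]
    refine ⟨x 0, ⟨h0.1, hx1 ▸ h1.1⟩, ?_, h0.2.2, h0.2.1⟩
    rw [mrsGap, hx1, h0.2.2, h1.2.2, sub_self]
  · rintro ⟨x, hx, hgap, hmrs, hval⟩
    have hmrs' : (c 1).mrs (r - x) = fun l => z (Sum.inl l) := by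
      rw [← hmrs, eq_comm, ← sub_eq_zero]
      exact hgap
    refine ⟨⟨fun l => ?_, ?_⟩, ![x, r - x], fun i => ?_, ?_⟩
    · refine Fin.lastCases ?_ (fun l => ?_) l
      · simp [priceOf]
      · have := SmoothConsumer.mrs_pos hx.1 l
        rw [hmrs] at this
        simpa [priceOf] using this
    · simp [priceOf]
    · fin_cases i
      · exact SmoothConsumer.isDemand_withNumeraire_iff.mpr ⟨hx.1, hval, hmrs⟩
      · refine SmoothConsumer.isDemand_withNumeraire_iff.mpr ⟨hx.2, ?_, hmrs'⟩
        change priceOf z ⬝ᵥ (r - x) = priceOf z ⬝ᵥ (r - endowmentOf z)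
        rw [dotProduct_sub, dotProduct_sub, hval]
    · simp [Fin.sum_univ_two]

theorem priceOf_pointOf (a : GoodsVec n × (Fin n → ℝ)) :
    priceOf (pointOf c a) = withNumeraire ((c 0).mrs a.1) := rfl

theorem endowmentOf_pointOf (a : GoodsVec n × (Fin n → ℝ)) :
    endowmentOf (pointOf c a) = a.1 + netTrade ((c 0).mrs a.1) a.2 := rfl

theorem pointOf_eq {z : Ambient n} {x : GoodsVec n}
    (hmrs : (c 0).mrs x = fun l => z (Sum.inl l))
    (hval : priceOf z ⬝ᵥ x = priceOf z ⬝ᵥ endowmentOf z) :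
    pointOf c (x, fun l => (endowmentOf z - x) l.castSucc) = z := by
  have hprice : priceOf z = withNumeraire ((c 0).mrs x) := by rw [hmrs]; rfl
  have hnet := netTrade_eq_self (q := (c 0).mrs x) (v := endowmentOf z - x)
    (by rw [← hprice, dotProduct_sub, hval, sub_self])
  ext i
  rcases i with l | l
  · exact congrFun hmrs l
  · change (x + netTrade ((c 0).mrs x) fun l => (endowmentOf z - x) l.castSucc) l
      = endowmentOf z l
    rw [hnet, add_sub_cancel]

/-- The equilibrium bundle at the point `pointOf c a` can only be `a.1`, because marginal rates of
substitution and value determine a bundle. -/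
theorem pointOf_mem_iff {a : GoodsVec n × (Fin n → ℝ)} (ha : a.1 ∈ feasibleBundles c r) :
    pointOf c a ∈ equilibriumManifold c r ↔ mrsGap c r a.1 = 0 := by
  have hval : priceOf (pointOf c a) ⬝ᵥ a.1 = priceOf (pointOf c a) ⬝ᵥ endowmentOf (pointOf c a) := by
    rw [priceOf_pointOf, endowmentOf_pointOf, dotProduct_add, withNumeraire_dotProduct_netTrade,
      add_zero]
  rw [mem_equilibriumManifold_iff]
  constructor
  · rintro ⟨x, hx, hgap, hmrs, hvalx⟩
    have : x = a.1 := by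
      refine SmoothConsumer.eq_of_mrs_eq hx.1 ha.1 hmrs ?_
      rw [hmrs]
      exact hvalx.trans hval.symm
    rwa [← this]
  · exact fun hgap => ⟨a.1, ha, hgap, rfl, hval⟩

theorem contDiffOn_pointOf :
    ContDiffOn ℝ ∞ (pointOf c) (feasibleBundles c r ×ˢ (Set.univ : Set (Fin n → ℝ))) := by
  have hmrs : ContDiffOn ℝ ∞ (fun a : GoodsVec n × (Fin n → ℝ) => (c 0).mrs a.1)
      (feasibleBundles c r ×ˢ (Set.univ : Set (Fin n → ℝ))) :=
    SmoothConsumer.contDiffOn_mrs.comp contDiffOn_fst fun a ha => ha.1.1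
  have hmrs' := contDiffOn_pi.mp hmrs
  refine (contDiffOn_piLp 2).mpr fun i => ?_
  rcases i with l | l
  · exact hmrs' l
  · change ContDiffOn ℝ ∞ (fun a : GoodsVec n × (Fin n → ℝ) => a.1 l + netTrade ((c 0).mrs a.1) a.2 l) _
    refine ContDiffOn.add (by fun_prop) ?_
    refine Fin.lastCases ?_ (fun l => ?_) l
    · simp only [netTrade_last]
      exact (ContDiffOn.sum fun l _ => (hmrs' l).mul (by fun_prop)).neg
    · simp only [netTrade_castSucc]
      fun_prop

/-- If prices do not move to first order, the endowment moves by `v` plus the net trade `σ`. If this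
vanishes too, `v` has value zero and is annihilated by the derivative of `mrs`, so negative
definiteness gives `v = 0`, and then `σ = 0`. -/
theorem fderiv_pointOf_injective {a : GoodsVec n × (Fin n → ℝ)}
    (ha : a.1 ∈ feasibleBundles c r) : Function.Injective (fderiv ℝ (pointOf c) a) := by
  have hmrs : HasFDerivAt (fun a : GoodsVec n × (Fin n → ℝ) => (c 0).mrs a.1)
      ((fderiv ℝ (c 0).mrs a.1).comp (ContinuousLinearMap.fst ℝ _ _)) a :=
    (SmoothConsumer.contDiffOn_mrs.differentiableAt_of_isOpen (c 0).isOpen_X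
      ha.1).hasFDerivAt.comp a hasFDerivAt_fst
  have hmrs' := hasFDerivAt_pi'.mp hmrs
  have hD : HasFDerivAt (pointOf c) (fderiv ℝ (pointOf c) a) a :=
    ((contDiffOn_pointOf (r := r)).differentiableAt_of_isOpen
      (isOpen_feasibleBundles.prod isOpen_univ) ⟨ha, trivial⟩).hasFDerivAt
  have hcoord (i : Fin n ⊕ Fin (n + 1)) : HasFDerivAt (fun a => pointOf c a i)
      ((EuclideanSpace.proj i : Ambient n →L[ℝ] ℝ) ∘L fderiv ℝ (pointOf c) a) a :=
    (EuclideanSpace.proj i : Ambient n →L[ℝ] ℝ).hasFDerivAt.comp a hD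
  refine (injective_iff_map_eq_zero _).mpr ?_
  rintro ⟨v, σ⟩ hv
  have hmrsv : fderiv ℝ (c 0).mrs a.1 v = 0 := funext fun l => by
    have := DFunLike.congr_fun ((hcoord (Sum.inl l)).unique (hmrs' l)) (v, σ)
    simp [hv] at this
    exact this.symm
  have hfst (l : Fin (n + 1)) : HasFDerivAt (fun a : GoodsVec n × (Fin n → ℝ) => a.1 l)
      ((ContinuousLinearMap.proj l : GoodsVec n →L[ℝ] ℝ).comp (ContinuousLinearMap.fst ℝ _ _)) a :=
    ((ContinuousLinearMap.proj l : GoodsVec n →L[ℝ] ℝ).comp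
      (ContinuousLinearMap.fst ℝ (GoodsVec n) (Fin n → ℝ))).hasFDerivAt
  have hsnd (l : Fin n) : HasFDerivAt (fun a : GoodsVec n × (Fin n → ℝ) => a.2 l)
      ((ContinuousLinearMap.proj l : (Fin n → ℝ) →L[ℝ] ℝ).comp
        (ContinuousLinearMap.snd ℝ _ _)) a :=
    ((ContinuousLinearMap.proj l : (Fin n → ℝ) →L[ℝ] ℝ).comp
      (ContinuousLinearMap.snd ℝ (GoodsVec n) (Fin n → ℝ))).hasFDerivAt
  have hcast (l : Fin n) : v l.castSucc + σ l = 0 := by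
    have h : HasFDerivAt (fun a => pointOf c a (Sum.inr l.castSucc)) _ a :=
      ((hfst l.castSucc).add (hsnd l)).congr_of_eventuallyEq
        (Eventually.of_forall fun b => by simp [pointOf])
    have := DFunLike.congr_fun ((hcoord (Sum.inr l.castSucc)).unique h) (v, σ)
    simp [hv] at this
    exact this.symm
  have hlast : v (Fin.last n) - ∑ l, (c 0).mrs a.1 l * σ l = 0 := by
    have h : HasFDerivAt (fun a => pointOf c a (Sum.inr (Fin.last n))) _ a :=
      ((hfst (Fin.last n)).sub (HasFDerivAt.fun_sum (u := Finset.univ) fun l _ =>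
        (hmrs' l).mul (hsnd l))).congr_of_eventuallyEq
        (Eventually.of_forall fun b => by simp [pointOf, sub_eq_add_neg])
    have := DFunLike.congr_fun ((hcoord (Sum.inr (Fin.last n))).unique h) (v, σ)
    simp [hv, hmrsv] at this
    exact this.symm
  have hσ (l : Fin n) : σ l = -v l.castSucc := by linarith [hcast l]
  have hv0 : v = 0 := by
    by_contra hne
    have := SmoothConsumer.fderiv_mrs_dotProduct_neg ha.1 hne (by
      rw [withNumeraire_dotProduct]
      simp only [hσ, mul_neg, Finset.sum_neg_distrib] at hlast
      linarith)
    simp [hmrsv] at this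
  have hσ0 : σ = 0 := funext fun l => by rw [hσ, hv0]; simp
  rw [hv0, hσ0]
  rfl

/-- At equal marginal rates of substitution both consumers have the same trades of value zero. The
two derivatives add, because the second bundle is `r - x`, and a sum of negative definite forms is
negative definite. The restriction to these trades is thus an injective endomorphism of `ℝ^n`, hence
onto. -/
theorem fderiv_mrsGap_surjective {x : GoodsVec n} (hx : x ∈ feasibleBundles c r)
    (hgap : mrsGap c r x = 0) : Function.Surjective (fderiv ℝ (mrsGap c r) x) := by
  have h₀ : HasFDerivAt (c 0).mrs (fderiv ℝ (c 0).mrs x) x :=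
    (SmoothConsumer.contDiffOn_mrs.differentiableAt_of_isOpen (c 0).isOpen_X hx.1).hasFDerivAt
  have h₁ : HasFDerivAt (c 1).mrs (fderiv ℝ (c 1).mrs (r - x)) (r - x) :=
    (SmoothConsumer.contDiffOn_mrs.differentiableAt_of_isOpen (c 1).isOpen_X hx.2).hasFDerivAt
  have hD (v : GoodsVec n) : fderiv ℝ (mrsGap c r) x v
      = fderiv ℝ (c 0).mrs x v + fderiv ℝ (c 1).mrs (r - x) v := by
    have h : HasFDerivAt (mrsGap c r) _ x :=
      h₀.sub (h₁.comp x ((hasFDerivAt_id x).const_sub r))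
    rw [h.fderiv]
    simp
  have hmrs : (c 1).mrs (r - x) = (c 0).mrs x := (sub_eq_zero.mp hgap).symm
  set T : (Fin n → ℝ) →ₗ[ℝ] (Fin n → ℝ) :=
    (fderiv ℝ (mrsGap c r) x : GoodsVec n →ₗ[ℝ] (Fin n → ℝ)) ∘ₗ netTradeLinear ((c 0).mrs x)
  have hT (s : Fin n → ℝ) : T s = fderiv ℝ (mrsGap c r) x (netTrade ((c 0).mrs x) s) := rfl
  have hinj : Function.Injective T := by
    refine (injective_iff_map_eq_zero T).mpr fun s hs => ?_
    by_contra hne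
    have hne' : netTrade ((c 0).mrs x) s ≠ 0 := fun h =>
      hne ((map_eq_zero_iff (netTradeLinear ((c 0).mrs x)) (netTrade_injective _)).mp h)
    have ha := SmoothConsumer.fderiv_mrs_dotProduct_neg hx.1 hne' (by simp)
    have hb := SmoothConsumer.fderiv_mrs_dotProduct_neg hx.2 hne' (by rw [hmrs]; simp)
    rw [hT, hD] at hs
    refine (add_neg ha hb).ne ?_
    rw [← Finset.sum_add_distrib]
    refine Finset.sum_eq_zero fun l _ => ?_
    rw [← add_mul, ← Pi.add_apply, hs, Pi.zero_apply, zero_mul]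
  intro y
  obtain ⟨s, hs⟩ := LinearMap.injective_iff_surjective.mp hinj y
  exact ⟨_, hs⟩

theorem isSubmanifold_equilibriumManifold (c : Fin 2 → SmoothConsumer n) (r : GoodsVec n) :
    IsSubmanifold (n + 1) (equilibriumManifold c r) := by
  refine isSubmanifold_of_regular_level_set (Y := Fin n → ℝ) (by simp) fun z hz => ?_
  obtain ⟨x, hx, hgap, hmrs, hval⟩ := mem_equilibriumManifold_iff.mp hz
  set a : GoodsVec n × (Fin n → ℝ) := (x, fun l => (endowmentOf z - x) l.castSucc) with ha
  have hpoint : pointOf c a = z := pointOf_eq hmrs hval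
  obtain ⟨e, he, hae, heO, hesymm⟩ := (contDiffOn_pointOf (c := c)
    (r := r)).exists_openPartialHomeomorph (z := a) (by simp; ring)
    (isOpen_feasibleBundles.prod isOpen_univ) ⟨hx, trivial⟩ (fderiv_pointOf_injective hx)
  have hze : e a = z := by rw [he, hpoint]
  have hzt : z ∈ e.target := hze ▸ e.map_source hae
  have hza : e.symm z = a := by rw [← hze, e.left_inv hae]
  have hfeas {w : Ambient n} (hw : w ∈ e.target) : (e.symm w).1 ∈ feasibleBundles c r :=
    (heO (e.map_target hw)).1
  refine ⟨e.target, e.open_target, hzt, fun w => mrsGap c r (e.symm w).1, ?_, fun w hw => ?_, ?_⟩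
  · exact contDiffOn_mrsGap.comp hesymm.fst fun w hw => hfeas hw
  · rw [← pointOf_mem_iff (hfeas hw), ← he, e.right_inv hw]
  · have hgapD : HasFDerivAt (mrsGap c r) (fderiv ℝ (mrsGap c r) x) (e.symm z).1 := by
      rw [hza]
      exact (contDiffOn_mrsGap.differentiableAt_of_isOpen isOpen_feasibleBundles hx).hasFDerivAt
    have hsymmD : HasFDerivAt e.symm (fderiv ℝ e.symm z) z :=
      (hesymm.differentiableAt_of_isOpen e.open_target hzt).hasFDerivAt
    have hD : HasFDerivAt (pointOf c) (fderiv ℝ (pointOf c) a) a :=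
      ((contDiffOn_pointOf (r := r)).differentiableAt_of_isOpen
        (isOpen_feasibleBundles.prod isOpen_univ) ⟨hx, trivial⟩).hasFDerivAt
    -- Since the derivatives of `e.symm` and `pointOf` compose to the identity, any variation `(v,
    -- 0)` of the bundle is attained, and surjectivity passes from `mrsGap` to the ambient equation.
    have hid : fderiv ℝ e.symm z ∘L fderiv ℝ (pointOf c) a = ContinuousLinearMap.id ℝ _ := by
      have hcomp := HasFDerivAt.comp a (g := e.symm) (f := pointOf c) (by rwa [hpoint]) hD
      refine hcomp.unique ((hasFDerivAt_id a).congr_of_eventuallyEq ?_)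
      refine eventuallyEq_of_mem (e.open_source.mem_nhds hae) fun b hb => ?_
      rw [Function.comp_apply, ← he, e.left_inv hb, id]
    have hfst : HasFDerivAt (fun w => (e.symm w).1)
        (ContinuousLinearMap.fst ℝ _ _ ∘L fderiv ℝ e.symm z) z := hsymmD.fst
    have htotal : HasFDerivAt (fun w => mrsGap c r (e.symm w).1)
        (fderiv ℝ (mrsGap c r) x ∘L ContinuousLinearMap.fst ℝ _ _ ∘L fderiv ℝ e.symm z) z :=
      HasFDerivAt.comp z (g := mrsGap c r) hgapD hfst
    rw [htotal.fderiv]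
    intro y
    obtain ⟨v, hv⟩ := fderiv_mrsGap_surjective hx hgap y
    refine ⟨fderiv ℝ (pointOf c) a (v, 0), ?_⟩
    have := DFunLike.congr_fun hid (v, 0)
    simp only [ContinuousLinearMap.comp_apply, ContinuousLinearMap.id_apply] at this ⊢
    rw [this]
    exact hv

/-- The direction in the ambient space in which prices are fixed and the endowment changes by a net
trade of value zero. -/
def fiberDirection (q : Fin n → ℝ) : (Fin n → ℝ) →ₗ[ℝ] Ambient n :=
  (WithLp.linearEquiv 2 ℝ (Fin n ⊕ Fin (n + 1) → ℝ)).symm.toLinearMap ∘ₗ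
    (LinearEquiv.sumArrowLequivProdArrow (Fin n) (Fin (n + 1)) ℝ ℝ).symm.toLinearMap ∘ₗ
      LinearMap.inr ℝ _ _ ∘ₗ netTradeLinear q

@[simp]
theorem fiberDirection_inl (q s : Fin n → ℝ) (l : Fin n) :
    fiberDirection q s (Sum.inl l) = 0 := rfl

@[simp]
theorem fiberDirection_inr (q s : Fin n → ℝ) (l : Fin (n + 1)) :
    fiberDirection q s (Sum.inr l) = netTrade q s l := rfl

theorem fiberDirection_injective (q : Fin n → ℝ) : Function.Injective (fiberDirection q) :=
  fun s t h => netTrade_injective q (funext fun l => by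
    rw [← fiberDirection_inr, h, fiberDirection_inr])

/-- The equilibrium manifold is ruled by the affine spaces of endowments of a given value at given
prices. -/
theorem add_fiberDirection_mem_equilibriumManifold {z : Ambient n}
    (hz : z ∈ equilibriumManifold c r) (s : Fin n → ℝ) :
    z + fiberDirection (fun l => z (Sum.inl l)) s ∈ equilibriumManifold c r := by
  obtain ⟨x, hx, hgap, hmrs, hval⟩ := mem_equilibriumManifold_iff.mp hz
  have hinl : (fun l => (z + fiberDirection (fun l => z (Sum.inl l)) s) (Sum.inl l))
      = fun l => z (Sum.inl l) := by
    funext l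
    simp
  have hprice : priceOf (z + fiberDirection (fun l => z (Sum.inl l)) s)
      = withNumeraire fun l => z (Sum.inl l) := congrArg withNumeraire hinl
  have hendow : endowmentOf (z + fiberDirection (fun l => z (Sum.inl l)) s)
      = endowmentOf z + netTrade (fun l => z (Sum.inl l)) s := by
    funext l
    simp [endowmentOf]
  refine mem_equilibriumManifold_iff.mpr ⟨x, hx, hgap, hmrs.trans hinl.symm, ?_⟩
  rw [hprice, hendow, dotProduct_add, withNumeraire_dotProduct_netTrade, add_zero]
  exact hval

theorem hasNonposSectionalCurvature_equilibriumManifold (c : Fin 2 → SmoothConsumer n)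
    (r : GoodsVec n) : HasNonposSectionalCurvature (n + 1) (equilibriumManifold c r) := by
  intro U Φ hpar x hx X Y hXY
  have hmem : Φ x ∈ equilibriumManifold c r := by
    obtain ⟨W, -, hW⟩ := hpar.open_image U subset_rfl hpar.isOpen
    exact (hW.subset (Set.mem_image_of_mem Φ hx)).1
  set q : Fin n → ℝ := fun l => Φ x (Sum.inl l)
  have hasym (s : Fin n → ℝ) :
      ∃ v, fderiv ℝ Φ x v = fiberDirection q s ∧ secondFundamentalForm Φ x v v = 0 :=
    hpar.exists_asymptotic_direction hx _ fun t => by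
      rw [← map_smul]
      exact add_fiberDirection_mem_equilibriumManifold hmem _
  obtain ⟨Q, hQ⟩ := LinearMap.exists_leftInverse_of_injective
    (fderiv ℝ Φ x : (Fin (n + 1) → ℝ) →ₗ[ℝ] Ambient n)
    (LinearMap.ker_eq_bot.mpr (hpar.immersion x hx))
  have hQΦ (v : Fin (n + 1) → ℝ) : Q (fderiv ℝ Φ x v) = v := LinearMap.congr_fun hQ v
  set J : (Fin n → ℝ) →ₗ[ℝ] (Fin (n + 1) → ℝ) := Q ∘ₗ fiberDirection q
  -- Injectivity of `DΦ(x)` makes the asymptotic preimage of each ruling direction the one given by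
  -- `J`, so asymptotic directions fill a linear subspace of dimension `n`.
  have hJ (s : Fin n → ℝ) : fderiv ℝ Φ x (J s) = fiberDirection q s ∧
      secondFundamentalForm Φ x (J s) (J s) = 0 := by
    obtain ⟨v, hv, hv0⟩ := hasym s
    have : J s = v := by rw [LinearMap.comp_apply, ← hv, hQΦ]
    rw [this]
    exact ⟨hv, hv0⟩
  have hJinj : Function.Injective J := fun s t hst =>
    fiberDirection_injective q (by rw [← (hJ s).1, hst, (hJ t).1])
  -- Dimension count: `n + 2 > n + 1`.
  have hnot : ¬ Disjoint J.range (Submodule.span ℝ (Set.range ![X, Y])) := fun hdisj => by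
    have := Submodule.finrank_add_finrank_le_of_disjoint hdisj
    rw [LinearMap.finrank_range_of_inj hJinj, finrank_span_eq_card hXY] at this
    simp at this
  obtain ⟨w, hwJ, hwXY, hw⟩ : ∃ w ∈ J.range, w ∈ Submodule.span ℝ (Set.range ![X, Y]) ∧ w ≠ 0 := by
    rw [Submodule.disjoint_def] at hnot
    push Not at hnot
    exact hnot
  obtain ⟨s, rfl⟩ := hwJ
  rw [Matrix.range_cons, Matrix.range_cons, Matrix.range_empty, Set.union_empty,
    Set.singleton_union, Submodule.mem_span_pair] at hwXY
  obtain ⟨a, b, hab⟩ := hwXY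
  refine sectionalCurvature_nonpos_of_asymptotic hpar.isOpen hpar.smooth hpar.immersion hx
    (a := a) (b := b) ?_ (by rw [hab]; exact (hJ s).2)
  by_contra! h
  rw [h.1, h.2, zero_smul, zero_smul, add_zero] at hab
  exact hw hab.symm

end EquilibriumManifold

end

theorem theorem3p1 (n : ℕ) (c : Fin 2 → SmoothConsumer n) (r : GoodsVec n) :
    IsSubmanifold (n + 1) (equilibriumManifold c r) ∧
      HasNonposSectionalCurvature (n + 1) (equilibriumManifold c r) :=
  ⟨isSubmanifold_equilibriumManifold c r, hasNonposSectionalCurvature_equilibriumManifold c r⟩
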